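/- Let $d,s$ be integers with $2\le s\le d$, and let $\sigma(t)=\max\{t,0\}$, applied componentwise to vectors. A filter is a real sequence $w=(w_k)_{k\in\mathbb Z}$ supported on $\{0,1,\dots,s\}$; for $v\in\mathbb R^{m}$ the zero-padded convolution $w*v\in\mathbb R^{m+s}$ is $$(w*v)_j=\sum_{k=1}^{m}w_{j-k}v_k,\qquad j=1,\dots,m+s .$$ For integers $m,n,\ell\ge1$, a block of depth $\ell$ from $\mathbb R^m$ to $\mathbb R^n$ is given by filters $w^1,\dots,w^\ell$, scalars $b^1,\dots,b^{\ell-1}$ and a vector $\vec b\in\mathbb R^{m+\ell s}$. It maps $x\in\mathbb R^m$ as follows: put $v^0=x$, $v^i=\sigma(w^i*v^{i-1}+b^i\mathbf 1)\in\mathbb R^{m+is}$ for $1\le i\le \ell-1$, and $v^\ell=\sigma(w^\ell*v^{\ell-1}+\vec b)\in\mathbb R^{m+\ell s}$; the output is the location-based pooling of $v^\ell$ with scaling parameter $m$ and location parameter $0$, that is, the vector $\big((v^\ell)_{km}\big)_{k=1}^{n}$, where entries with $km>m+\ell s$ are read as $0$. Let $$\ell_1=\Big\lceil\frac{d(d+1)}{s-1}\Big\rceil,\qquad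 \ell_j=\Big\lceil\frac{(d+1)^2}{s-1}\Big\rceil\quad(j\ge2).$$ For $L\ge1$ let $\mathcal H_L$ be the set of all functions $x\mapsto \vec a\cdot (V_L\circ\cdots\circ V_1)(x)$ on $[0,1]^d$, where $\vec a\in\mathbb R^{d+1}$, $V_1$ is a block of depth $\ell_1$ from $\mathbb R^d$ to $\mathbb R^{d+1}$, and, for $2\le j\le L$, $V_j$ is a block of depth $\ell_j$ from $\mathbb R^{d+1}$ to $\mathbb R^{d+1}$. Then for every $\varepsilon>0$ and every continuous $f:[0,1]^d\to\mathbb R$ there is an integer $L\ge1$ such that $$\operatorname{dist}(f,\mathcal H_L):=\inf_{g\in\mathcal H_L}\ \max_{x\in[0,1]^d}|f(x)-g(x)|<\varepsilon .$$ -/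

import Mathlib

namespace EDCNN

/-- The unit cube `[0,1]^d`. -/
abbrev Cube (d : ℕ) : Type := Set.Icc (0 : Fin d → ℝ) 1

/-- Componentwise ReLU. -/
noncomputable def relu {n : ℕ} (x : Fin n → ℝ) : Fin n → ℝ := fun i => max (x i) 0

/-- A filter (a two-sided real sequence) supported on `{0, 1, …, s}`. -/
def IsFilter (s : ℕ) (w : ℤ → ℝ) : Prop := ∀ k : ℤ, w k ≠ 0 → 0 ≤ k ∧ k ≤ s

/-- The zero-padded (expansive) convolution `(w * v)_j = ∑_k w_{j-k} v_k`, from `ℝ^m` to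
`ℝ^{m+s}`. Coordinates are numbered from `0` instead of `1`, which leaves `j - k` unchanged. -/
def conv (s : ℕ) {m : ℕ} (w : ℤ → ℝ) (v : Fin m → ℝ) : Fin (m + s) → ℝ :=
  fun j => ∑ k : Fin m, w ((j : ℤ) - (k : ℤ)) * v k

/-- The layer widths of a block with input dimension `m`: `d_0 = m` and `d_ℓ = d_{ℓ-1} + s`. -/
def width (s m : ℕ) : ℕ → ℕ
  | 0 => m
  | l + 1 => width s m l + s

theorem width_eq (s m l : ℕ) : width s m l = m + l * s := by
  induction l with
  | zero => simp [width]
  | succ l ih => rw [width, ih]; ring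

/-- The restricted feature extractor with `ℓ` layers: the `i`-th layer (`1 ≤ i ≤ ℓ`) is
`v ↦ σ (w^i * v + b^i 𝟏)`, with one scalar bias per layer. -/
noncomputable def restrictedFeature (s m : ℕ) (w : ℕ → ℤ → ℝ) (b : ℕ → ℝ) :
    (l : ℕ) → (Fin m → ℝ) → Fin (width s m l) → ℝ
  | 0, x => x
  | l + 1, x => relu (conv s (w (l + 1)) (restrictedFeature s m w b l x) + fun _ => b (l + 1))

/-- Location-based pooling `v ↦ (v_{ku+j})_{k=1}^{⌊D/u⌋}` with scaling parameter `u` and location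
parameter `j`, where `v_i = 0` for `i > D`. The `1`-based index `ku+j` is the `0`-based index
`ku+j-1`. -/
noncomputable def pool {D : ℕ} (u j : ℕ) (v : Fin D → ℝ) : Fin (D / u) → ℝ :=
  fun k => if h : (k.val + 1) * u + j - 1 < D then v ⟨(k.val + 1) * u + j - 1, h⟩ else 0

/-- A vector regarded as an element of `ℝ^n`: the first `n` coordinates, with zeros where there
are none. -/
noncomputable def toDim {D : ℕ} (n : ℕ) (v : Fin D → ℝ) : Fin n → ℝ :=
  fun i => if h : i.val < D then v ⟨i.val, h⟩ else 0

/-- The free parameters of a block of depth `l ≥ 1` with input dimension `m`: filters `w^1, …, w^l`,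
scalar biases `b^1, …, b^{l-1}` and a bias vector for the last layer, which has width `m + l s`.
Entries of `filter` and `bias` with other indices are not used. -/
structure Block (s m l : ℕ) where
  filter : ℕ → ℤ → ℝ
  isFilter : ∀ i, IsFilter s (filter i)
  bias : ℕ → ℝ
  lastBias : Fin (width s m (l - 1) + s) → ℝ

/-- The feature map of a block of depth `l ≥ 1` with input dimension `m`: `l - 1` restricted layers,
then a convolutional layer with a full bias vector, then pooling with scaling parameter `m` and
location parameter `j`, regarded as a vector of `ℝ^n`. -/
noncomputable def Block.map {s m l : ℕ} (B : Block s m l) (n j : ℕ) (x : Fin m → ℝ) : Fin n → ℝ :=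
  toDim n (pool m j (relu
    (conv s (B.filter l) (restrictedFeature s m B.filter B.bias (l - 1) x) + B.lastBias)))

/-- The dimensions between the blocks: `d_0^* = d`, and `d_j^* = dstar j` for `j ≥ 1`. -/
def dims (d : ℕ) (dstar : ℕ → ℕ) : ℕ → ℕ
  | 0 => d
  | j + 1 => dstar (j + 1)

/-- The composition of the first `L` blocks, with pooling at location `0`. The block number `j + 1`
is `B j`; it has depth `depth (j + 1)` and maps `ℝ^{d_j^*}` to `ℝ^{d_{j+1}^*}`. -/
noncomputable def features (s d : ℕ) (dstar depth : ℕ → ℕ)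
    (B : (j : ℕ) → Block s (dims d dstar j) (depth (j + 1))) :
    (L : ℕ) → (Fin d → ℝ) → Fin (dims d dstar L) → ℝ
  | 0, x => x
  | L + 1, x => (B L).map (dims d dstar (L + 1)) 0 (features s d dstar depth B L x)

/-- The set of eDCNNs with `L` blocks of depths `depth 1, …, depth L`, dimensions
`d, dstar 1, …, dstar L` between them and pooling at location `0`, as functions on the cube:
all `x ↦ a · features(x)`. -/
def networks (s d : ℕ) (dstar depth : ℕ → ℕ) (L : ℕ) : Set C(Cube d, ℝ) :=
  {g | ∃ (B : (j : ℕ) → Block s (dims d dstar j) (depth (j + 1)))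
      (a : Fin (dims d dstar L) → ℝ),
      ∀ x : Cube d, g x = a ⬝ᵥ features s d dstar depth B L x.val}

end EDCNN

namespace EDCNN

open Polynomial

/-! Convolution is polynomial multiplication, and a real polynomial splits into factors of degree at
most `s`. Large biases keep the inner ReLUs inactive on a compact set, so a block convolves with one
long filter; pooling reads off its inner products with the input, giving any fully connected ReLU
layer (`exists_block_map_eq`). Stacked blocks therefore form a ReLU network of width `d + 1`: `d`
channels carry the nonnegative input and one accumulates a max-min string of affine functions. Such
strings are dense (`exists_isMaxMinString_abs_sub_le`): near a point of maximal norm in the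
remaining set, two more affine functions correct the approximation on a small cap and preserve it on
the rest. -/

/-! ### Factorization of real polynomials -/

/-- A real polynomial of degree at least `k` has a divisor of degree `k` or `k + 1`. -/
theorem exists_factor_natDegree (P : ℝ[X]) (k : ℕ) (hk : k ≤ P.natDegree) :
    ∃ F G : ℝ[X], P = F * G ∧ k ≤ F.natDegree ∧ F.natDegree ≤ k + 1 := by
  induction k with
  | zero => exact ⟨1, P, by simp⟩
  | succ k ih =>
    obtain ⟨F, G, rfl, h1, h2⟩ := ih (by omega)
    rcases h1.lt_or_eq with h | h
    · exact ⟨F, G, rfl, h, by omega⟩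
    have hFG : F * G ≠ 0 := by
      rintro h0
      simp [h0] at hk
    have hG : G ≠ 0 := right_ne_zero_of_mul hFG
    rw [natDegree_mul (left_ne_zero_of_mul hFG) hG] at hk
    have hGu : ¬ IsUnit G := fun hu => by
      have := natDegree_eq_zero_of_isUnit hu
      omega
    -- Real irreducibles have degree 1 or 2, so `F * q`, with `F` of degree `k`, has degree `k + 1`
    -- or `k + 2`.
    obtain ⟨q, hq, H, rfl⟩ := WfDvdMonoid.exists_irreducible_factor hGu hG
    refine ⟨F * q, H, by ring, ?_⟩
    rw [natDegree_mul (left_ne_zero_of_mul hFG) hq.ne_zero]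
    have := hq.natDegree_le_two
    have := hq.natDegree_pos
    omega

/-- A real polynomial of degree at most `q (s - 1) + 1` is a product of `q` polynomials of degree
at most `s`. -/
theorem exists_prod_natDegree_le {s : ℕ} (hs : 2 ≤ s) (q : ℕ) (P : ℝ[X])
    (hP : P.natDegree ≤ (q + 1) * (s - 1) + 1) :
    ∃ F : ℕ → ℝ[X], (∀ i, (F i).natDegree ≤ s) ∧ P = ∏ i ∈ Finset.range (q + 1), F i := by
  induction q generalizing P with
  | zero => exact ⟨fun _ => P, fun _ => by dsimp only; omega, by simp⟩
  | succ q ih =>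
    obtain ⟨A, G, hAG, hA, hG⟩ : ∃ A G : ℝ[X], P = A * G ∧ A.natDegree ≤ s ∧
        G.natDegree ≤ (q + 1) * (s - 1) + 1 := by
      -- A divisor of degree `s - 1` or `s` is split off, lowering the degree by at least `s - 1`.
      by_cases h : s - 1 ≤ P.natDegree
      · obtain ⟨A, G, hAG, h1, h2⟩ := exists_factor_natDegree P (s - 1) h
        refine ⟨A, G, hAG, by omega, ?_⟩
        by_cases h0 : A * G = 0
        · rw [hAG, h0, natDegree_zero] at h
          omega
        rw [hAG, natDegree_mul (left_ne_zero_of_mul h0) (right_ne_zero_of_mul h0)] at hP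
        have : (q + 1 + 1) * (s - 1) = (q + 1) * (s - 1) + (s - 1) := by ring
        omega
      · exact ⟨P, 1, by simp, by omega, by simp⟩
    obtain ⟨F, hF, rfl⟩ := ih G hG
    refine ⟨fun i => if i = q + 1 then A else F i, fun i => ?_, ?_⟩
    · dsimp only
      split_ifs
      exacts [hA, hF i]
    · rw [Finset.prod_range_succ, if_pos rfl, hAG, mul_comm]
      congr 1
      refine Finset.prod_congr rfl fun i hi => ?_
      rw [if_neg (by have := Finset.mem_range.1 hi; omega)]

/-! ### Convolution as polynomial multiplication -/

/-- The two-sided sequence of coefficients of a polynomial. -/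
noncomputable def coeffSeq (P : ℝ[X]) (k : ℤ) : ℝ := if 0 ≤ k then P.coeff k.toNat else 0

theorem isFilter_coeffSeq {s : ℕ} {P : ℝ[X]} (hP : P.natDegree ≤ s) : IsFilter s (coeffSeq P) := by
  intro k hk
  unfold coeffSeq at hk
  split_ifs at hk with h
  · have := le_natDegree_of_ne_zero hk
    omega
  · exact absurd rfl hk

theorem coeff_mul_ofFn (P : ℝ[X]) {m : ℕ} (v : Fin m → ℝ) (j : ℕ) :
    (P * ofFn m v).coeff j = ∑ k : Fin m, coeffSeq P ((j : ℤ) - (k : ℤ)) * v k := by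
  rw [ofFn_eq_sum_monomial, Finset.mul_sum, finsetSum_coeff]
  refine Finset.sum_congr rfl fun k _ => ?_
  rw [← C_mul_X_pow_eq_monomial, mul_comm (C (v k)), ← mul_assoc, coeff_mul_C, coeff_mul_X_pow',
    coeffSeq]
  congr 1
  by_cases h : (k : ℕ) ≤ j
  · rw [if_pos h, if_pos (by omega)]
    congr 1
    omega
  · rw [if_neg h, if_neg (by omega)]

theorem conv_coeffSeq (s : ℕ) {m : ℕ} (P : ℝ[X]) (v : Fin m → ℝ) (j : Fin (m + s)) :
    conv s (coeffSeq P) v j = (P * ofFn m v).coeff j := (coeff_mul_ofFn P v j).symm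

theorem ofFn_conv_coeffSeq {s m : ℕ} {P : ℝ[X]} (hP : P.natDegree ≤ s) (v : Fin m → ℝ) :
    ofFn (m + s) (conv s (coeffSeq P) v) = P * ofFn m v := by
  ext i
  by_cases hi : i < m + s
  · rw [ofFn_coeff_eq_val_of_lt _ hi, conv_coeffSeq]
  · rw [ofFn_coeff_eq_zero_of_ge _ (by omega)]
    by_cases h0 : P * ofFn m v = 0
    · rw [h0, coeff_zero]
    refine (coeff_eq_zero_of_natDegree_lt ?_).symm
    rw [natDegree_mul (left_ne_zero_of_mul h0) (right_ne_zero_of_mul h0)]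
    have hm : 1 ≤ m := by
      rcases Nat.eq_zero_or_pos m with rfl | h
      · exact absurd (by ext; simp) h0
      · exact h
    have := ofFn_natDegree_lt hm v
    omega

/-! ### Fully connected layers from blocks -/

theorem continuous_relu {n : ℕ} : Continuous (relu (n := n)) := by
  unfold relu
  fun_prop

theorem continuous_conv (s m : ℕ) (w : ℤ → ℝ) : Continuous (conv s (m := m) w) := by
  unfold conv
  fun_prop

theorem continuous_restrictedFeature (s m : ℕ) (w : ℕ → ℤ → ℝ) (b : ℕ → ℝ) (l : ℕ) :
    Continuous (restrictedFeature s m w b l) := by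
  induction l with
  | zero => exact continuous_id
  | succ l ih =>
    exact continuous_relu.comp (((continuous_conv s _ _).comp ih).add continuous_const)

theorem continuous_map {s m l : ℕ} (B : Block s m l) (n j : ℕ) : Continuous (B.map n j) := by
  have h : Continuous fun x => relu (conv s (B.filter l)
      (restrictedFeature s m B.filter B.bias (l - 1) x) + B.lastBias) :=
    continuous_relu.comp (((continuous_conv s _ _).comp
      (continuous_restrictedFeature s m _ _ _)).add continuous_const)
  refine continuous_pi fun i => ?_
  unfold Block.map toDim pool
  split_ifs with h₁ h₂
  · exact continuous_pi_iff.1 h ⟨_, h₂⟩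
  · exact continuous_const
  · exact continuous_const

theorem restrictedFeature_congr {s m : ℕ} {w : ℕ → ℤ → ℝ} {b b' : ℕ → ℝ} {l : ℕ}
    (h : ∀ i ≤ l, b i = b' i) (x : Fin m → ℝ) :
    restrictedFeature s m w b l x = restrictedFeature s m w b' l x := by
  induction l with
  | zero => rfl
  | succ l ih =>
    simp only [restrictedFeature]
    rw [ih fun i hi => h i (by omega), h (l + 1) le_rfl]

/-- With large scalar biases the restricted layers act affinely on a given compact set: up to an
additive constant, they multiply by the product of the filters. -/
theorem exists_bias_restrictedFeature {s m : ℕ} {K : Set (Fin m → ℝ)} (hK : IsCompact K)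
    (P : ℕ → ℝ[X]) (hP : ∀ i, (P i).natDegree ≤ s) (l : ℕ) :
    ∃ (b : ℕ → ℝ) (Q : ℝ[X]), ∀ x ∈ K,
      ofFn _ (restrictedFeature s m (fun i => coeffSeq (P i)) b l x) =
        (∏ i ∈ Finset.range l, P (i + 1)) * ofFn m x + Q := by
  induction l with
  | zero => exact ⟨0, 0, fun x _ => by
    rw [Finset.prod_range_zero, one_mul, add_zero]
    rfl⟩
  | succ l ih =>
    obtain ⟨b, Q, hb⟩ := ih
    obtain ⟨c, hc⟩ := (hK.image ((continuous_conv s _ (coeffSeq (P (l + 1)))).comp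
      (continuous_restrictedFeature s m (fun i => coeffSeq (P i)) b l))).isBounded.exists_norm_le
    -- As `c` bounds the convolution on `K`, adding it makes the ReLU the identity there.
    refine ⟨Function.update b (l + 1) c, P (l + 1) * Q + ofFn (width s m l + s) (fun _ => c),
      fun x hx => ?_⟩
    have hcongr : restrictedFeature s m (fun i => coeffSeq (P i)) (Function.update b (l + 1) c) l x
        = restrictedFeature s m (fun i => coeffSeq (P i)) b l x :=
      restrictedFeature_congr (fun i hi => Function.update_of_ne (by omega) _ _) x
    set u : Fin (width s m l + s) → ℝ := conv s (coeffSeq (P (l + 1)))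
      (restrictedFeature s m (fun i => coeffSeq (P i)) b l x) with hu
    have hrelu : restrictedFeature s m (fun i => coeffSeq (P i)) (Function.update b (l + 1) c)
        (l + 1) x = relu (u + fun _ => c) := by
      simp only [restrictedFeature]
      rw [hcongr, Function.update_self]
    have hpos : relu (u + fun _ => c) = u + fun _ => c := by
      funext j
      refine max_eq_left ?_
      have h1 : |u j| ≤ c := (norm_le_pi_norm u j).trans (hc _ ⟨x, hx, rfl⟩)
      have h2 := neg_le_of_abs_le h1
      simp only [Pi.add_apply]
      linarith
    rw [hrelu]
    change ofFn (width s m l + s) (relu (u + fun _ => c)) = _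
    rw [hpos, map_add, hu, ofFn_conv_coeffSeq (hP _), hb x hx, Finset.prod_range_succ]
    ring

/-- A block whose depth `l` satisfies `n m ≤ l (s - 1)` can realize any fully connected ReLU layer
from `ℝ^m` to `ℝ^n` on a given compact set. -/
theorem exists_block_map_eq {s m n l : ℕ} (hs : 2 ≤ s) (hm : 0 < m) (hn : 0 < n)
    (hl : n * m ≤ l * (s - 1)) {K : Set (Fin m → ℝ)} (hK : IsCompact K)
    (A : Fin n → Fin m → ℝ) (β : Fin n → ℝ) :
    ∃ B : Block s m l, ∀ x ∈ K, B.map n 0 x = relu fun k => A k ⬝ᵥ x + β k := by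
  have hnm : 0 < n * m := Nat.mul_pos hn hm
  obtain ⟨l, rfl⟩ : ∃ l', l = l' + 1 := Nat.exists_eq_succ_of_ne_zero (by rintro rfl; omega)
  -- The rows of `A`, each reversed, are concatenated: the coefficient of `W * x` at the pooled
  -- index `(k + 1) * m - 1` is then `A k ⬝ᵥ x`.
  set W : ℝ[X] := ofFn (n * m) fun i => A i.divNat i.modNat.rev with hW
  have hWdeg : W.natDegree < n * m := ofFn_natDegree_lt hnm _
  obtain ⟨F, hF, hWF⟩ := exists_prod_natDegree_le hs l W (by omega)
  have hWc : ∀ (k : Fin n) (j : Fin m),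
      coeffSeq W ((((k + 1) * m - 1 : ℕ) : ℤ) - (j : ℤ)) = A k j := by
    intro k j
    have hj := j.2
    have h1 : (k + 1 : ℕ) * m = m * k + m := by ring
    have hlt : m * k + (m - 1 - j) < n * m := by
      have : (k + 1 : ℕ) * m ≤ n * m := Nat.mul_le_mul_right m k.2
      omega
    have h2 : (((k + 1 : ℕ) * m - 1 : ℕ) : ℤ) - (j : ℤ) = ((m * k + (m - 1 - j) : ℕ) : ℤ) := by
      omega
    rw [h2, coeffSeq, if_pos (by positivity), Int.toNat_natCast, hW,
      ofFn_coeff_eq_val_of_lt _ hlt]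
    congr 1
    · ext
      simp only [Fin.coe_divNat]
      rw [Nat.mul_add_div hm, Nat.div_eq_of_lt (by omega), add_zero]
    · ext
      simp only [Fin.val_rev, Fin.coe_modNat]
      rw [Nat.mul_add_mod, Nat.mod_eq_of_lt (by omega)]
      omega
  obtain ⟨b, Q, hb⟩ := exists_bias_restrictedFeature hK (fun i => F (i - 1)) (fun i => hF _) l
  -- The last bias cancels the accumulated constant `F l * Q` and inserts `β k` at `j = (k + 1) * m
  -- - 1`; its values at positions not pooled are immaterial.
  refine ⟨⟨fun i => coeffSeq (F (i - 1)), fun i => isFilter_coeffSeq (hF _), b,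
    fun j => (if h : (j + 1 : ℕ) / m - 1 < n then β ⟨_, h⟩ else 0) - (F l * Q).coeff j⟩,
    fun x hx => ?_⟩
  have hD : m + n * m ≤ width s m l + s := by
    have h1 : (l + 1) * (s - 1) ≤ (l + 1) * s := Nat.mul_le_mul_left _ (by omega)
    have h2 : width s m l + s = m + (l + 1) * s := width_eq s m (l + 1)
    omega
  funext k
  have h1 : (k + 1 : ℕ) * m = m * k + m := by ring
  have hk : (k + 1 : ℕ) * m ≤ n * m := Nat.mul_le_mul_right m k.2
  have hkD : (k : ℕ) < (width s m l + s) / m := by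
    rw [Nat.lt_div_iff_mul_lt hm]
    have : (k : ℕ) * m ≤ n * m := Nat.mul_le_mul_right m k.2.le
    rw [mul_comm]
    omega
  have hkD' : (k + 1 : ℕ) * m + 0 - 1 < width s m l + s := by omega
  have hdiv : ((k + 1 : ℕ) * m + 0 - 1 + 1) / m - 1 = k := by
    rw [add_zero, Nat.sub_add_cancel (by omega), Nat.mul_div_cancel _ hm, Nat.add_sub_cancel]
  simp only [Block.map, toDim, pool, Nat.add_sub_cancel]
  rw [dif_pos hkD, dif_pos hkD']
  simp only [relu, Pi.add_apply]
  rw [conv_coeffSeq]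
  change max ((F l * ofFn (width s m l)
    (restrictedFeature s m (fun i => coeffSeq (F (i - 1))) b l x)).coeff _ + _) 0 = _
  rw [hb x hx, mul_add, coeff_add]
  simp only [hdiv, Fin.is_lt, dif_pos, Fin.eta, Nat.add_sub_cancel]
  rw [← mul_assoc, mul_comm (F l), ← Finset.prod_range_succ, ← hWF, coeff_mul_ofFn]
  simp only [add_zero, hWc]
  congr 1
  simp only [dotProduct]
  ring

/-! ### Density of max-min strings -/

/-- Functions obtained from an affine function by repeatedly taking the maximum or the minimum with
an affine function. -/
inductive IsMaxMinString {d : ℕ} : ((Fin d → ℝ) → ℝ) → Prop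
  | affine (a : Fin d → ℝ) (c : ℝ) : IsMaxMinString fun x => a ⬝ᵥ x + c
  | max (a : Fin d → ℝ) (c : ℝ) {g : (Fin d → ℝ) → ℝ} (hg : IsMaxMinString g) :
      IsMaxMinString fun x => max (a ⬝ᵥ x + c) (g x)
  | min (a : Fin d → ℝ) (c : ℝ) {g : (Fin d → ℝ) → ℝ} (hg : IsMaxMinString g) :
      IsMaxMinString fun x => min (a ⬝ᵥ x + c) (g x)

/-- The right side is the squared Euclidean distance; the coordinatewise bound passes to the sup
metric. -/
theorem sq_sub_le_dotProduct {d : ℕ} (x p : Fin d → ℝ) (i : Fin d) :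
    (x i - p i) ^ 2 ≤ x ⬝ᵥ x - 2 * (x ⬝ᵥ p) + p ⬝ᵥ p := by
  have h : x ⬝ᵥ x - 2 * (x ⬝ᵥ p) + p ⬝ᵥ p = ∑ i, (x i - p i) ^ 2 := by
    simp only [dotProduct, Finset.mul_sum, ← Finset.sum_sub_distrib, ← Finset.sum_add_distrib]
    exact Finset.sum_congr rfl fun i _ => by ring
  rw [h]
  exact Finset.single_le_sum (f := fun i => (x i - p i) ^ 2) (fun i _ => sq_nonneg _)
    (Finset.mem_univ i)

/-- Expand `0 ≤ ‖x - p‖²` in the Euclidean norm. A point `p` of maximal norm thus also maximizes `x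
⬝ᵥ p`. -/
theorem dotProduct_le_of_dotProduct_self_le {d : ℕ} {x p : Fin d → ℝ} (h : x ⬝ᵥ x ≤ p ⬝ᵥ p) :
    x ⬝ᵥ p ≤ p ⬝ᵥ p := by
  have h0 : 0 ≤ (x - p) ⬝ᵥ (x - p) := Finset.sum_nonneg fun i _ => mul_self_nonneg _
  rw [sub_dotProduct, dotProduct_sub, dotProduct_sub, dotProduct_comm p x] at h0
  linarith

/-- Replacing `t` by `max (u + r) (min (u - r) t)` corrects an approximation of `y` where `r ≥ 0`
and preserves it where `r ≤ 0`. -/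
theorem abs_max_min_sub_le {ε M r t u y : ℝ} (hM : |u - y| ≤ M)
    (hr : r ≤ ε / 2) (hnear : -M < r → |u - y| ≤ ε / 2) (ht : r ≤ 0 → |t - y| ≤ ε) (hε : 0 < ε) :
    |max (u + r) (min (u - r) t) - y| ≤ ε := by
  rw [abs_le] at hM
  rcases le_or_gt r 0 with h0 | h0
  · have ht' := abs_le.1 (ht h0)
    -- Either `u` is close to `y`, or `r ≤ -M` outweighs its error.
    have hu : u + r ≤ y + ε ∧ y - ε ≤ u - r := by
      by_cases hr' : -M < r
      · have := abs_le.1 (hnear hr')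
        constructor <;> linarith
      · constructor <;> linarith
    rw [abs_le]
    constructor
    · have := (le_min hu.2 (by linarith : y - ε ≤ t)).trans (le_max_right (u + r) _)
      linarith
    · have := max_le hu.1 ((min_le_right (u - r) t).trans (by linarith : t ≤ y + ε))
      linarith
  · have := abs_le.1 (hnear (by linarith))
    rw [max_eq_left ((min_le_left _ _).trans (by linarith)), abs_le]
    constructor <;> linarith

/-- Max-min strings are dense in the continuous functions on the cube. A set is exhausted by
cutting off caps at points of maximal Euclidean norm; such caps have small diameter. -/
theorem exists_isMaxMinString_abs_sub_le {d : ℕ} {f : (Fin d → ℝ) → ℝ}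
    (hf : ContinuousOn f (Set.Icc 0 1)) {ε : ℝ} (hε : 0 < ε) :
    ∃ g, IsMaxMinString g ∧ ∀ x ∈ Set.Icc (0 : Fin d → ℝ) 1, |g x - f x| ≤ ε := by
  have hK : IsCompact (Set.Icc (0 : Fin d → ℝ) 1) := isCompact_Icc
  obtain ⟨C, hC⟩ := (hK.image_of_continuousOn hf).isBounded.exists_norm_le
  obtain ⟨δ, hδ, hfδ⟩ := Metric.uniformContinuousOn_iff_le.1
    (hK.uniformContinuousOn_of_continuous hf) (ε / 2) (by positivity)
  obtain ⟨M, hM, hfM⟩ : ∃ M, 0 < M ∧ ∀ x ∈ Set.Icc (0 : Fin d → ℝ) 1,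
      ∀ y ∈ Set.Icc (0 : Fin d → ℝ) 1, |f x - f y| ≤ M := by
    refine ⟨|C| + |C| + 1, by positivity, fun x hx y hy => (abs_sub _ _).trans ?_⟩
    have h1 := hC _ ⟨x, hx, rfl⟩
    have h2 := hC _ ⟨y, hy, rfl⟩
    rw [Real.norm_eq_abs] at h1 h2
    have := le_abs_self C
    linarith
  -- `θ` is the depth of a cap of diameter about `δ`, and `κ` the depth of the part cut off.
  set θ : ℝ := δ ^ 2 / 2 with hθ
  have hθ0 : 0 < θ := by positivity
  set κ : ℝ := θ / (1 + 2 * M / ε) with hκ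
  have hκ0 : 0 < κ := by positivity
  -- With slope `ε / (2 * κ)`, the tilt `r` of `abs_max_min_sub_le` is `ε / 2` at `p`, `0` at depth
  -- `κ` and `-M` at depth `θ`.
  have hκθ : ε / (2 * κ) * (θ - κ) = M := by
    have : κ * (1 + 2 * M / ε) = θ := by rw [hκ]; field_simp
    rw [← this]
    field_simp
    ring
  set r : ℝ := κ / (2 * (d + 1)) with hr
  have hr0 : 0 < r := by positivity
  -- The induction is on the number of covering balls: `r` is so small that the ball containing `p`
  -- meets `K` only inside the cap cut off.
  have key : ∀ (n : ℕ) (t : Finset (Fin d → ℝ)), t.card = n → ∀ K ⊆ Set.Icc (0 : Fin d → ℝ) 1,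
      IsClosed K → K ⊆ ⋃ x ∈ t, Metric.ball x r →
      ∃ g, IsMaxMinString g ∧ ∀ x ∈ K, |g x - f x| ≤ ε := by
    intro n
    induction n with
    | zero =>
      intro t ht K _ _ hKt
      rw [Finset.card_eq_zero] at ht
      subst ht
      refine ⟨_, .affine 0 0, fun x hx => ?_⟩
      simpa using hKt hx
    | succ n ih =>
      intro t ht K hK1 hKc hKt
      rcases K.eq_empty_or_nonempty with rfl | hne
      · exact ⟨_, .affine 0 0, fun x hx => absurd hx (Set.notMem_empty x)⟩
      obtain ⟨p, hpK, hpmax⟩ := (hK.of_isClosed_subset hKc hK1).exists_isMaxOn hne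
        (f := fun x => x ⬝ᵥ x) (by fun_prop)
      obtain ⟨z, hzt, hpz⟩ := Set.mem_iUnion₂.1 (hKt hpK)
      have hclose : ∀ y ∈ Metric.ball z r, p ⬝ᵥ p - κ < p ⬝ᵥ y := by
        intro y hy
        have hpy : dist p y < 2 * r := by
          have := dist_triangle_right p y z
          rw [Metric.mem_ball] at hpz hy
          linarith
        have h1 : p ⬝ᵥ p - p ⬝ᵥ y ≤ ∑ _i : Fin d, 2 * r := by
          rw [← dotProduct_sub]
          refine Finset.sum_le_sum fun i _ => ?_
          have h2 : |p i - y i| ≤ 2 * r := (dist_le_pi_dist p y i).trans hpy.le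
          have h3 : 0 ≤ p i := (hK1 hpK).1 i
          have h4 : p i ≤ 1 := (hK1 hpK).2 i
          have h5 := le_abs_self (p i - y i)
          simp only [Pi.sub_apply]
          nlinarith
        have h2 : ∑ _i : Fin d, 2 * r < κ := by
          have h3 : 2 * (d + 1) * r = κ := by rw [hr]; field_simp
          simp only [Finset.sum_const, Finset.card_univ, Fintype.card_fin, nsmul_eq_mul]
          linarith
        linarith
      obtain ⟨g, hg, hgK⟩ := ih (t.erase z) (by rw [Finset.card_erase_of_mem hzt, ht]; rfl)
        (K ∩ {x | p ⬝ᵥ x ≤ p ⬝ᵥ p - κ}) (Set.inter_subset_left.trans hK1)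
        (hKc.inter (isClosed_le (by fun_prop) continuous_const)) (by
          rintro y ⟨hyK, hy⟩
          obtain ⟨z', hz't, hyz'⟩ := Set.mem_iUnion₂.1 (hKt hyK)
          refine Set.mem_iUnion₂.2 ⟨z', Finset.mem_erase.2 ⟨?_, hz't⟩, hyz'⟩
          rintro rfl
          exact absurd (hclose y hyz') (not_lt.2 hy))
      set α := ε / (2 * κ) with hα
      have hα0 : 0 < α := by positivity
      refine ⟨_, .max (α • p) (f p - α * (p ⬝ᵥ p - κ)) (.min (-(α • p))
        (f p + α * (p ⬝ᵥ p - κ)) hg), fun x hx => ?_⟩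
      have e1 : (α • p) ⬝ᵥ x + (f p - α * (p ⬝ᵥ p - κ)) = f p + α * (p ⬝ᵥ x - (p ⬝ᵥ p - κ)) := by
        rw [smul_dotProduct, smul_eq_mul]
        ring
      have e2 : (-(α • p)) ⬝ᵥ x + (f p + α * (p ⬝ᵥ p - κ)) =
          f p - α * (p ⬝ᵥ x - (p ⬝ᵥ p - κ)) := by
        rw [neg_dotProduct, smul_dotProduct, smul_eq_mul]
        ring
      rw [e1, e2]
      have hxp : x ⬝ᵥ x ≤ p ⬝ᵥ p := hpmax hx
      refine abs_max_min_sub_le (hfM _ (hK1 hpK) _ (hK1 hx)) ?_ ?_ ?_ hε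
      · have h1 := dotProduct_le_of_dotProduct_self_le hxp
        have h2 : α * κ = ε / 2 := by rw [hα]; field_simp
        rw [← h2]
        refine mul_le_mul_of_nonneg_left ?_ hα0.le
        rw [dotProduct_comm p x]
        linarith
      -- Tilt above `-M` means depth below `θ`; with `x ⬝ᵥ x ≤ p ⬝ᵥ p` this gives squared distance
      -- to `p` below `2 * θ = δ ^ 2`.
      · intro h
        rw [← hκθ, ← mul_neg, mul_lt_mul_iff_right₀ hα0] at h
        refine hfδ _ (hK1 hpK) _ (hK1 hx) ((dist_pi_le_iff hδ.le).2 fun i => ?_)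
        have h1 := sq_sub_le_dotProduct x p i
        rw [dotProduct_comm x p] at h1
        rw [dist_comm, Real.dist_eq]
        refine abs_le_of_sq_le_sq (h1.trans ?_) hδ.le
        have : δ ^ 2 = 2 * θ := by rw [hθ]; ring
        linarith
      · intro h
        refine hgK x ⟨hx, ?_⟩
        have := nonpos_of_mul_nonpos_right h hα0
        simp only [Set.mem_ofPred_eq]
        linarith
  obtain ⟨t, _, htf, htK⟩ := hK.finite_cover_balls hr0
  obtain ⟨g, hg, hgf⟩ := key _ htf.toFinset rfl _ subset_rfl hK.isClosed (by simpa using htK)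
  exact ⟨g, hg, hgf⟩

/-! ### Composition of blocks -/

section features

variable {s d : ℕ} {dstar depth : ℕ → ℕ}

theorem features_congr {B B' : (j : ℕ) → Block s (dims d dstar j) (depth (j + 1))} {L : ℕ}
    (h : ∀ j < L, B j = B' j) (x : Fin d → ℝ) :
    features s d dstar depth B L x = features s d dstar depth B' L x := by
  induction L with
  | zero => rfl
  | succ L ih =>
    simp only [features]
    rw [ih fun j hj => h j (by omega), h L (by omega)]

theorem continuous_features (B : (j : ℕ) → Block s (dims d dstar j) (depth (j + 1))) (L : ℕ) :
    Continuous (features s d dstar depth B L) := by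
  induction L with
  | zero => exact continuous_id
  | succ L ih => exact (continuous_map (B L) _ 0).comp ih

/-- A network can be extended by a block that acts on a given compact set of inputs as a given
fully connected ReLU layer. -/
theorem exists_features_succ_eq (hs : 2 ≤ s) (hd : ∀ j, 0 < dims d dstar j)
    (hdepth : ∀ j, dims d dstar (j + 1) * dims d dstar j ≤ depth (j + 1) * (s - 1))
    {K : Set (Fin d → ℝ)} (hK : IsCompact K)
    (B : (j : ℕ) → Block s (dims d dstar j) (depth (j + 1))) (L : ℕ)
    (A : Fin (dims d dstar (L + 1)) → Fin (dims d dstar L) → ℝ)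
    (β : Fin (dims d dstar (L + 1)) → ℝ) :
    ∃ B' : (j : ℕ) → Block s (dims d dstar j) (depth (j + 1)), ∀ x ∈ K,
      features s d dstar depth B' (L + 1) x =
        relu fun k => A k ⬝ᵥ features s d dstar depth B L x + β k := by
  obtain ⟨V, hV⟩ := exists_block_map_eq hs (hd L) (hd (L + 1)) (hdepth L)
    (hK.image (continuous_features B L)) A β
  refine ⟨Function.update B L V, fun x hx => ?_⟩
  rw [features, Function.update_self,
    features_congr (B' := B) (fun j hj => Function.update_of_ne (by omega) _ _) x]
  exact hV _ ⟨x, hx, rfl⟩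

end features

/-! ### Max-min strings as networks of width `d + 1` -/

/-- `φ` agrees on the cube with the feature map of a network with at least one block, whose blocks
have depths `ℓ` and output dimension `d + 1`. -/
def IsFeatureMap (s d : ℕ) (ℓ : ℕ → ℕ) (φ : (Fin d → ℝ) → Fin (d + 1) → ℝ) : Prop :=
  ∃ (L : ℕ) (B : (j : ℕ) → Block s (dims d (fun _ => d + 1) j) (ℓ (j + 1))),
    ∀ x ∈ Set.Icc (0 : Fin d → ℝ) 1, features s d (fun _ => d + 1) ℓ B (L + 1) x = φ x

theorem dims_pos {d : ℕ} (hd : 0 < d) (j : ℕ) : 0 < dims d (fun _ => d + 1) j := by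
  cases j
  · exact hd
  · exact Nat.succ_pos d

section width

variable {s d : ℕ} {ℓ : ℕ → ℕ}

theorem isFeatureMap_relu (hs : 2 ≤ s) (hd : 0 < d)
    (hℓ : ∀ j, dims d (fun _ => d + 1) (j + 1) * dims d (fun _ => d + 1) j ≤ ℓ (j + 1) * (s - 1))
    (A : Fin (d + 1) → Fin d → ℝ) (β : Fin (d + 1) → ℝ) :
    IsFeatureMap s d ℓ fun x => relu fun k => A k ⬝ᵥ x + β k := by
  obtain ⟨B, hB⟩ := exists_features_succ_eq hs (dims_pos hd) hℓ
    (isCompact_Icc (a := (0 : Fin d → ℝ)) (b := 1))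
    (fun _ => ⟨0, fun _ k hk => absurd rfl hk, 0, 0⟩) 0 A β
  exact ⟨0, B, hB⟩

theorem IsFeatureMap.relu_comp (hs : 2 ≤ s) (hd : 0 < d)
    (hℓ : ∀ j, dims d (fun _ => d + 1) (j + 1) * dims d (fun _ => d + 1) j ≤ ℓ (j + 1) * (s - 1))
    {φ : (Fin d → ℝ) → Fin (d + 1) → ℝ} (hφ : IsFeatureMap s d ℓ φ)
    (A : Fin (d + 1) → Fin (d + 1) → ℝ) (β : Fin (d + 1) → ℝ) :
    IsFeatureMap s d ℓ fun x => relu fun k => A k ⬝ᵥ φ x + β k := by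
  obtain ⟨L, B, hB⟩ := hφ
  obtain ⟨B', hB'⟩ := exists_features_succ_eq hs (dims_pos hd) hℓ
    (isCompact_Icc (a := (0 : Fin d → ℝ)) (b := 1)) B (L + 1) A β
  refine ⟨L + 1, B', fun x hx => (hB' x hx).trans ?_⟩
  rw [hB x hx]
  rfl

theorem IsFeatureMap.congr {φ ψ : (Fin d → ℝ) → Fin (d + 1) → ℝ} (hφ : IsFeatureMap s d ℓ φ)
    (h : ∀ x ∈ Set.Icc (0 : Fin d → ℝ) 1, φ x = ψ x) : IsFeatureMap s d ℓ ψ := by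
  obtain ⟨L, B, hB⟩ := hφ
  exact ⟨L, B, fun x hx => (hB x hx).trans (h x hx)⟩

theorem snoc_dotProduct_snoc (a x : Fin d → ℝ) (α v : ℝ) :
    (Fin.snoc a α : Fin (d + 1) → ℝ) ⬝ᵥ (Fin.snoc x v : Fin (d + 1) → ℝ) = a ⬝ᵥ x + α * v := by
  simp [dotProduct, Fin.sum_univ_castSucc]

/-- One block can carry the input along and update an additional channel by
`v ↦ σ (α v + a · x + c)`. -/
theorem IsFeatureMap.snoc_update (hs : 2 ≤ s) (hd : 0 < d)
    (hℓ : ∀ j, dims d (fun _ => d + 1) (j + 1) * dims d (fun _ => d + 1) j ≤ ℓ (j + 1) * (s - 1))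
    {v : (Fin d → ℝ) → ℝ} (hv : IsFeatureMap s d ℓ fun x => Fin.snoc x (v x))
    (α : ℝ) (a : Fin d → ℝ) (c : ℝ) :
    IsFeatureMap s d ℓ fun x => Fin.snoc x (max (α * v x + (a ⬝ᵥ x + c)) 0) := by
  refine (hv.relu_comp hs hd hℓ
    (Fin.snoc (α := fun _ => Fin (d + 1) → ℝ) (fun i => Fin.snoc (Pi.single i 1) 0)
      (Fin.snoc a α)) (Fin.snoc 0 c)).congr fun x hx => ?_
  funext k
  refine Fin.lastCases ?_ (fun i => ?_) k
  · simp only [relu, Fin.snoc_last, snoc_dotProduct_snoc]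
    congr 1
    ring
  · have : 0 ≤ x i := hx.1 i
    simp [relu, Fin.snoc_castSucc, snoc_dotProduct_snoc, this]

/-- A max-min string is, on the cube, an affine function of the input and a channel that networks
with output dimension `d + 1` can compute while carrying the input along. -/
theorem IsMaxMinString.exists_isFeatureMap (hs : 2 ≤ s) (hd : 0 < d)
    (hℓ : ∀ j, dims d (fun _ => d + 1) (j + 1) * dims d (fun _ => d + 1) j ≤ ℓ (j + 1) * (s - 1))
    {g : (Fin d → ℝ) → ℝ} (hg : IsMaxMinString g) :
    ∃ (v : (Fin d → ℝ) → ℝ) (α : ℝ) (a : Fin d → ℝ) (c : ℝ),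
      IsFeatureMap s d ℓ (fun x => Fin.snoc x (v x)) ∧ ∀ x, g x = α * v x + (a ⬝ᵥ x + c) := by
  induction hg with
  | affine a c =>
    refine ⟨0, 0, a, c, (isFeatureMap_relu hs hd hℓ
      (Fin.snoc (α := fun _ => Fin d → ℝ) (fun i => Pi.single i 1) 0) 0).congr fun x hx => ?_,
      fun x => by simp⟩
    funext k
    refine Fin.lastCases ?_ (fun i => ?_) k
    · simp [relu]
    · have : 0 ≤ x i := hx.1 i
      simp [relu, this]
  | max a' c' _ ih =>
    obtain ⟨v, α, a, c, hv, hg⟩ := ih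
    -- With `h = a' ⬝ᵥ x + c'`, `max h g = h + σ (g - h)`; below, `min h g = h - σ (h - g)`.
    refine ⟨_, 1, a', c', hv.snoc_update hs hd hℓ α (a - a') (c - c'), fun x => ?_⟩
    dsimp only
    rw [hg, sub_dotProduct, one_mul, max_add, zero_add, max_comm]
    congr 1
    ring
  | min a' c' _ ih =>
    obtain ⟨v, α, a, c, hv, hg⟩ := ih
    refine ⟨_, -1, a', c', hv.snoc_update hs hd hℓ (-α) (a' - a) (c' - c), fun x => ?_⟩
    dsimp only
    rw [hg, sub_dotProduct, neg_one_mul, ← min_neg_neg, min_add, neg_zero, zero_add, min_comm]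
    congr 1
    ring

theorem IsMaxMinString.continuous {g : (Fin d → ℝ) → ℝ} (hg : IsMaxMinString g) :
    Continuous g := by
  induction hg with
  | affine a c => fun_prop
  | max a c _ ih => fun_prop
  | min a c _ ih => fun_prop

/-- The restriction of a max-min string to the cube is a network. -/
theorem IsMaxMinString.exists_mem_networks (hs : 2 ≤ s) (hd : 0 < d)
    (hℓ : ∀ j, dims d (fun _ => d + 1) (j + 1) * dims d (fun _ => d + 1) j ≤ ℓ (j + 1) * (s - 1))
    {g : (Fin d → ℝ) → ℝ} (hg : IsMaxMinString g) :
    ∃ L, 1 ≤ L ∧ (⟨fun x : Cube d => g x, hg.continuous.comp continuous_subtype_val⟩ :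
      C(Cube d, ℝ)) ∈ networks s d (fun _ => d + 1) ℓ L := by
  obtain ⟨v, α, a, c, hv, hgv⟩ := hg.exists_isFeatureMap hs hd hℓ
  obtain ⟨C, hC⟩ := ((isCompact_Icc (a := (0 : Fin d → ℝ)) (b := 1)).image
    hg.continuous).isBounded.exists_norm_le
  -- The readout has no bias and follows a ReLU, so one more block outputs `g + C ≥ 0` and the
  -- constant `C`, whose difference is `g`.
  obtain ⟨L, B, hB⟩ := hv.relu_comp hs hd hℓ
    (fun k => if k = 0 then Fin.snoc a α else 0) (fun k => if k = 0 then c + C else C)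
  have hlast : Fin.last d ≠ 0 := by
    rw [Ne, Fin.ext_iff]
    simp only [Fin.val_last, Fin.val_zero]
    omega
  refine ⟨L + 1, by omega, B,
    (Pi.single 0 1 - Pi.single (Fin.last d) 1 : Fin (d + 1) → ℝ), fun x => ?_⟩
  have hgC : |g x| ≤ C := hC _ ⟨x, x.2, rfl⟩
  have hC0 : 0 ≤ C := (abs_nonneg _).trans hgC
  rw [hB x x.2]
  change g x = (Pi.single 0 1 - Pi.single (Fin.last d) 1 : Fin (d + 1) → ℝ) ⬝ᵥ _
  have h1 : a ⬝ᵥ (x : Fin d → ℝ) + α * v x + (c + C) = g x + C := by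
    rw [hgv]
    ring
  have h2 : 0 ≤ g x + C := by linarith [neg_le_of_abs_le hgC]
  rw [sub_dotProduct, single_dotProduct, single_dotProduct]
  simp only [relu, if_pos, if_neg hlast, snoc_dotProduct_snoc, zero_dotProduct, h1]
  rw [max_eq_left h2, zero_add, max_eq_left hC0]
  ring

end width

/-! ### Depth count and conclusion -/

/-- Blocks of the depths in question are deep enough to realize every fully connected layer. -/
theorem dims_mul_dims_le {d s : ℕ} (hs : 2 ≤ s) {ℓ : ℕ → ℕ}
    (hℓ₁ : ℓ 1 = ⌈(d : ℝ) * ((d : ℝ) + 1) / ((s : ℝ) - 1)⌉₊)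
    (hℓ : ∀ j, 2 ≤ j → ℓ j = ⌈((d : ℝ) + 1) ^ 2 / ((s : ℝ) - 1)⌉₊) (j : ℕ) :
    dims d (fun _ => d + 1) (j + 1) * dims d (fun _ => d + 1) j ≤ ℓ (j + 1) * (s - 1) := by
  have hs0 : (0 : ℝ) < (s : ℝ) - 1 := by
    have : (2 : ℝ) ≤ s := by exact_mod_cast hs
    linarith
  have hsc : ((s - 1 : ℕ) : ℝ) = (s : ℝ) - 1 := by
    rw [Nat.cast_sub (by omega), Nat.cast_one]
  rw [← Nat.cast_le (α := ℝ), Nat.cast_mul (ℓ (j + 1)), hsc, ← div_le_iff₀ hs0]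
  cases j with
  | zero =>
    rw [zero_add, hℓ₁]
    refine le_trans (le_of_eq ?_) (Nat.le_ceil _)
    simp only [dims]
    push_cast
    ring
  | succ j =>
    rw [hℓ _ (by omega)]
    refine le_trans (le_of_eq ?_) (Nat.le_ceil _)
    simp only [dims]
    push_cast
    ring

end EDCNN

/-- Nonemptiness is included because `Metric.infDist` to the empty set is `0`. -/
theorem corollary5 (d s : ℕ) (hs : 2 ≤ s) (hsd : s ≤ d)
    (ℓ : ℕ → ℕ)
    (hℓ₁ : ℓ 1 = ⌈(d : ℝ) * ((d : ℝ) + 1) / ((s : ℝ) - 1)⌉₊)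
    (hℓ : ∀ j, 2 ≤ j → ℓ j = ⌈((d : ℝ) + 1) ^ 2 / ((s : ℝ) - 1)⌉₊)
    (ε : ℝ) (hε : 0 < ε) (f : C(EDCNN.Cube d, ℝ)) :
    ∃ L : ℕ, 1 ≤ L ∧
      (EDCNN.networks s d (fun _ => d + 1) ℓ L).Nonempty ∧
      Metric.infDist f (EDCNN.networks s d (fun _ => d + 1) ℓ L) < ε := by
  classical
  set F : (Fin d → ℝ) → ℝ := fun x => if h : x ∈ Set.Icc 0 1 then f ⟨x, h⟩ else 0 with hF
  have hFf : ∀ x : EDCNN.Cube d, F x = f x := fun x => dif_pos x.2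
  have hFc : ContinuousOn F (Set.Icc 0 1) := by
    rw [continuousOn_iff_continuous_domRestrict]
    exact f.continuous.congr fun x => (hFf x).symm
  obtain ⟨g, hg, hgF⟩ := EDCNN.exists_isMaxMinString_abs_sub_le hFc (half_pos hε)
  obtain ⟨L, hL, hgL⟩ :=
    hg.exists_mem_networks hs (by omega) (EDCNN.dims_mul_dims_le hs hℓ₁ hℓ)
  refine ⟨L, hL, ⟨_, hgL⟩, (Metric.infDist_le_dist_of_mem hgL).trans_lt
    (lt_of_le_of_lt ?_ (half_lt_self hε))⟩
  refine (ContinuousMap.dist_le (half_pos hε).le).2 fun x => ?_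
  rw [dist_comm, Real.dist_eq, ← hFf]
  exact hgF x x.2
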